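/- Let $(X,d)$ be a compact metric space and let $\mathrm{Hom}(X)$ be the space of homeomorphisms $X\to X$ with the metric $d_{C^0}(f,g)=\max_{x\in X}d(f(x),g(x))$. Let $f\in \mathrm{Hom}(X)$. For a metric $\rho$ on $X$ compatible with its topology, a point $x\in X$ is strong chain recurrent for $(f,\rho)$ if for every $\varepsilon>0$ there are $n\ge 1$ and points $x=x_1,x_2,\dots,x_n,x_{n+1}=x$ of $X$ with $\sum_{i=1}^n\rho(f(x_i),x_{i+1})<\varepsilon$. The set of these points is $\mathcal{SCR}_\rho(f)$. The generalized recurrent set is $\mathcal{GR}(f)=\bigcap_\rho \mathcal{SCR}_\rho(f)$, the intersection being over all metrics $\rho$ on $X$ compatible with the topology of $X$. If $\mathcal{GR}(f)\neq X$, we say that $f$ does not permit $\mathcal{GR}$-explosions if for every open set $U\supseteq\mathcal{GR}(f)$ there is a neighborhood $N$ of $f$ in $\mathrm{Hom}(X)$ such that $\mathcal{GR}(g)\subseteq U$ for all $g\in N$. An open decomposition of $f$ is a finite family $V_1,\dots,V_k$ of open subsets of $X$ with pairwise disjoint closures such that $\mathcal{GR}(f)\subseteq\bigcup_{i=1}^kV_i$.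 For $i\ne j$ write $V_i\ge V_j$ if there are $x\in V_j$ and $m\ge 0$ with $f^{-m}(x)\in V_i$. For $r>1$, the sets $V_{i_1},\dots,V_{i_r}$ form an $r$ cycle if $V_{i_1}\ge V_{i_2}\ge\dots\ge V_{i_r}\ge V_{i_1}$. The set $V_j$ forms a $1$ cycle if there are $x\notin V_j$ and integers $m,q>0$ with $f^m(x)\in V_j$ and $f^{-q}(x)\in V_j$. The open decomposition has no cycles if no members of it form an $r$ cycle, for any $r\ge 1$. **Theorem.** Let $M$ be a compact topological manifold (without boundary, with a metric $d$ compatible with its topology) of dimension at least $2$, and let $f\in\mathrm{Hom}(M)$ be such that $\mathcal{GR}(f)\ne M$. If $f$ does not permit $\mathcal{GR}$-explosions, then for every open neighborhood $U$ of $\mathcal{GR}(f)$ there is an open decomposition $V_1,\dots,V_k$ of $f$ with no cycles such that $$\mathcal{GR}(f)\subseteq\bigcup_{i=1}^kV_i\subseteq U.$$ -/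

import Mathlib

open Set Topology

namespace GenRec

/-- The space `Hom(X)` of homeomorphisms of a compact metric space, as a metric space for the
uniform distance `d_{C⁰}(f, g) = max_x d (f x) (g x)` (see `dist_homeo_eq`). -/
noncomputable instance homeoMetricSpace {X : Type*} [MetricSpace X] [CompactSpace X] :
    MetricSpace (X ≃ₜ X) :=
  MetricSpace.induced (fun f : X ≃ₜ X => (⟨f, f.continuous⟩ : C(X, X)))
    (fun _ _ h => Homeomorph.ext fun x => DFunLike.congr_fun h x) inferInstance

theorem dist_homeo_eq {X : Type*} [MetricSpace X] [CompactSpace X] (f g : X ≃ₜ X) :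
    dist f g = ⨆ x, dist (f x) (g x) :=
  ContinuousMap.dist_eq_iSup (f := ⟨f, f.continuous⟩) (g := ⟨g, g.continuous⟩)

/-- There is a strong `ε`-chain of `f` from `x` to `y` for the distance function `d`: points
`c 0 = x, c 1, …, c (n - 1)` with `n ≥ 1` such that, with `c n = y`, the jumps
`d (f (c i)) (c (i + 1))`, `i < n`, have sum less than `ε`. -/
def StrongChain {X : Type*} (d : X → X → ℝ) (f : X → X) (ε : ℝ) (x y : X) : Prop :=
  ∃ n : ℕ, 1 ≤ n ∧ ∃ c : ℕ → X, c 0 = x ∧ c n = y ∧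
    ∑ i ∈ Finset.range n, d (f (c i)) (c (i + 1)) < ε

/-- The strong chain recurrent set of `f` for the distance function `d`. -/
def strongChainRecurrentSet {X : Type*} (d : X → X → ℝ) (f : X → X) : Set X :=
  {x | ∀ ε : ℝ, 0 < ε → StrongChain d f ε x x}

/-- The generalized recurrent set of `f`: the intersection of the strong chain recurrent sets
of `f` over all metrics that induce the topology of `X`. -/
def generalizedRecurrentSet {X : Type*} [t : TopologicalSpace X] (f : X → X) : Set X :=
  ⋂ (m : MetricSpace X) (_ : m.toUniformSpace.toTopologicalSpace = t),
    strongChainRecurrentSet m.dist f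

/-- `f` does not permit explosions of the generalized recurrent set. -/
def NoGRExplosions {X : Type*} [MetricSpace X] [CompactSpace X] (f : X ≃ₜ X) : Prop :=
  ∀ U : Set X, IsOpen U → generalizedRecurrentSet f ⊆ U →
    ∃ N ∈ 𝓝 f, ∀ g ∈ N, generalizedRecurrentSet g ⊆ U

/-- The set `V^u` of the points `x` with `f⁻ᵐ x ∈ V` for some `m ≥ 0`. -/
def unstableSet {X : Type*} [TopologicalSpace X] (f : X ≃ₜ X) (V : Set X) : Set X :=
  {x | ∃ m : ℕ, f.symm^[m] x ∈ V}

/-- `V 0, …, V (k - 1)` is an open decomposition of `f`. -/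
structure IsOpenDecomposition {X : Type*} [TopologicalSpace X] (f : X ≃ₜ X) {k : ℕ}
    (V : Fin k → Set X) : Prop where
  isOpen : ∀ i, IsOpen (V i)
  disjoint_closure : ∀ i j, i ≠ j → Disjoint (closure (V i)) (closure (V j))
  subset_iUnion : generalizedRecurrentSet f ⊆ ⋃ i, V i

/-- The relation `V i ≥ V j` between two different members of the family. -/
def Leads {X : Type*} [TopologicalSpace X] (f : X ≃ₜ X) {k : ℕ} (V : Fin k → Set X)
    (i j : Fin k) : Prop :=
  i ≠ j ∧ (V j ∩ unstableSet f (V i)).Nonempty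

/-- `V (s 0) ≥ V (s 1) ≥ … ≥ V (s (r - 1)) ≥ V (s 0)`, with `r > 1`; `finRotate r` is the
cyclic successor on `Fin r`. -/
def IsLongCycle {X : Type*} [TopologicalSpace X] (f : X ≃ₜ X) {k : ℕ} (V : Fin k → Set X)
    (r : ℕ) (s : Fin r → Fin k) : Prop :=
  1 < r ∧ ∀ a : Fin r, Leads f V (s a) (s (finRotate r a))

/-- `V j` forms a `1` cycle: some orbit leaves `V j` and comes back to it. -/
def IsOneCycle {X : Type*} [TopologicalSpace X] (f : X ≃ₜ X) {k : ℕ} (V : Fin k → Set X)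
    (j : Fin k) : Prop :=
  ∃ x, x ∉ V j ∧ ∃ m q : ℕ, 0 < m ∧ 0 < q ∧ f^[m] x ∈ V j ∧ f.symm^[q] x ∈ V j

/-- The family `V` has no `r` cycles for any `r ≥ 1`. -/
def HasNoCycles {X : Type*} [TopologicalSpace X] (f : X ≃ₜ X) {k : ℕ} (V : Fin k → Set X) :
    Prop :=
  (∀ (r : ℕ) (s : Fin r → Fin k), ¬ IsLongCycle f V r s) ∧ ∀ j : Fin k, ¬ IsOneCycle f V j

end GenRec

namespace GenRec

/-! Call an open `Ω` with `f (closure Ω) ⊆ Ω` an attractor block and `f⁻¹ Ω \ closure Ω` its gap. If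
no closed `ε`-chain passes through `x`, then `x` lies in the gap of the block of points reached from
`x` by `ε / 2`-chains. Generalized recurrent points never lie in a gap
(`mem_block_of_mem_generalizedRecurrentSet`). So if no point off `U` is chain recurrent, compactness
gives finitely many blocks whose gaps cover the complement of `U`. Sort the points outside the gaps
by the blocks that contain them: orbits enter blocks but never leave them, so this pattern can only
grow along an orbit, which rules out cycles (`exists_decomposition_of_not_chainRecurrent`).

That chain recurrent points lie in `U` follows from a `C⁰` closing lemma
(`exists_homeomorph_isPeriodicPt`). A shortest closed chain has distinct points, so one
homeomorphism near the identity can correct all its jumps; composed with `f`, it makes `x` periodic.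
Periodic points are generalized recurrent, and the absence of explosions puts `x` in `U`.

The correction needs dimension at least 2: in a chart, each displacement is split along two
transverse hyperplanes and realized by two cut-off shears (`exists_ballMove`). Compactness then
combines the charts (`HasSmallMoves.union`). -/

/-- One step of an `ε`-chain of `f`. -/
def ChainStep {X : Type*} [PseudoMetricSpace X] (f : X → X) (ε : ℝ) (x y : X) : Prop :=
  dist (f x) y < ε

/-- The points reached from `x` by `ε`-chains of `f` with at least one step. -/
def chainReach {X : Type*} [PseudoMetricSpace X] (f : X → X) (ε : ℝ) (x : X) : Set X :=
  {y | Relation.TransGen (ChainStep f ε) x y}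

/-! ### Chains and attractor blocks -/

section Chains

variable {X : Type*} [MetricSpace X] {f : X → X} {ε : ℝ} {x : X}

theorem isOpen_chainReach : IsOpen (chainReach f ε x) := by
  rw [Metric.isOpen_iff]
  intro y hy
  obtain ⟨z, hxz, hzy⟩ := (Relation.TransGen.tail'_iff).1 hy
  refine ⟨ε - dist (f z) y, sub_pos.2 hzy, fun w hw => Relation.TransGen.tail' hxz ?_⟩
  have h1 := dist_triangle (f z) y w
  rw [Metric.mem_ball, dist_comm] at hw
  unfold ChainStep
  linarith

/-- A reached point `z` close enough to `y` has `f z` within `ε` of `f y`, so one more jump lands on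
`f y`. Hence the reach is an attractor block. -/
theorem map_closure_chainReach (hf : Continuous f) (hε : 0 < ε) {y : X}
    (hy : y ∈ closure (chainReach f ε x)) : f y ∈ chainReach f ε x := by
  obtain ⟨z, hz, hzx⟩ := mem_closure_iff.1 hy (f ⁻¹' Metric.ball (f y) ε)
    (Metric.isOpen_ball.preimage hf) (by simpa using hε)
  exact Relation.TransGen.tail hzx hz

/-- Halving `ε` leaves room to redirect the last jump from a point within `ε / 2` of `x` to `x`
itself. -/
theorem notMem_closure_chainReach (hε : 0 < ε) (hx : ¬ Relation.TransGen (ChainStep f ε) x x) :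
    x ∉ closure (chainReach f (ε / 2) x) := by
  intro h
  obtain ⟨y, hy, hxy⟩ := Metric.mem_closure_iff.1 h (ε / 2) (half_pos hε)
  obtain ⟨z, hxz, hzy⟩ := (Relation.TransGen.tail'_iff).1 hy
  have hle : ChainStep f (ε / 2) ≤ ChainStep f ε := fun a b hab =>
    lt_of_lt_of_le hab (half_le_self hε.le)
  refine hx (Relation.TransGen.tail' (Relation.ReflTransGen.mono hle _ _ hxz) ?_)
  · have h1 := dist_triangle_right (f z) x y
    have h2 : dist (f z) y < ε / 2 := hzy
    unfold ChainStep
    linarith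

theorem StrongChain.transGen {y : X} (h : StrongChain dist f ε x y) :
    Relation.TransGen (ChainStep f ε) x y := by
  obtain ⟨n, hn, c, rfl, rfl, hsum⟩ := h
  have hstep : ∀ i < n, ChainStep f ε (c i) (c (i + 1)) := fun i hi =>
    lt_of_le_of_lt (Finset.single_le_sum (f := fun i => dist (f (c i)) (c (i + 1)))
      (fun _ _ => dist_nonneg) (Finset.mem_range.2 hi)) hsum
  have key : ∀ k, k + 1 ≤ n → Relation.TransGen (ChainStep f ε) (c 0) (c (k + 1)) := by
    intro k
    induction k with
    | zero => exact fun h => .single (hstep 0 h)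
    | succ k ih => exact fun h => (ih (by omega)).tail (hstep _ h)
  obtain ⟨k, rfl⟩ := Nat.exists_eq_add_of_le' hn
  exact key k le_rfl

theorem transGen_of_mem_generalizedRecurrentSet
    (hx : x ∈ generalizedRecurrentSet f) (hε : 0 < ε) :
    Relation.TransGen (ChainStep f ε) x x := by
  have h := mem_iInter₂.1 hx inferInstance rfl
  exact StrongChain.transGen (h ε hε)

/-- The orbit itself is a closed chain with zero jumps, whatever the metric. -/
theorem mem_generalizedRecurrentSet_of_isPeriodicPt {X : Type*} [TopologicalSpace X] {f : X → X}
    {x : X} {n : ℕ} (hn : 0 < n) (hx : f^[n] x = x) : x ∈ generalizedRecurrentSet f := by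
  refine mem_iInter₂.2 fun m _ ε hε => ⟨n, hn, fun i => f^[i] x, rfl, hx, ?_⟩
  simpa [Function.iterate_succ_apply'] using hε

/-- A generalized recurrent point whose image is in the closure of an attractor block is in the
block. -/
theorem mem_block_of_mem_generalizedRecurrentSet [CompactSpace X] (hf : Continuous f) {Ω : Set X}
    (hΩ : IsOpen Ω) (hfΩ : ∀ y ∈ closure Ω, f y ∈ Ω) {y : X}
    (hy : y ∈ generalizedRecurrentSet f) (hfy : f y ∈ closure Ω) : y ∈ Ω := by
  by_contra hyΩ
  have hne : 0 < dist (f y) y := by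
    refine dist_pos.2 fun h => hyΩ ?_
    have := hfΩ _ hfy
    rwa [h, h] at this
  have hK : IsCompact (f '' closure Ω) := isClosed_closure.isCompact.image hf
  obtain ⟨δ, hδ, hδΩ⟩ := hK.exists_thickening_subset_open hΩ (image_subset_iff.2 hfΩ)
  obtain ⟨η, hη, hηf⟩ := Metric.continuous_iff.1 hf (f y) (δ / 2) (half_pos hδ)
  set ε := min (dist (f y) y) (min (δ / 2) η)
  have hε : 0 < ε := lt_min hne (lt_min (half_pos hδ) hη)
  have hε1 : ε ≤ dist (f y) y := min_le_left _ _
  have hε2 : ε ≤ δ / 2 := (min_le_right _ _).trans (min_le_left _ _)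
  have hε3 : ε ≤ η := (min_le_right _ _).trans (min_le_right _ _)
  -- Only the first point after `y` can miss `Ω`. It is within `η` of `f y`, so its image is within
  -- `δ / 2` of `f (f y)`, and a further jump below `δ / 2` stays in the thickening. The bound `ε ≤
  -- dist (f y) y` excludes a return to `y` at that first step.
  have key : ∀ z, Relation.TransGen (ChainStep f ε) y z → z ∈ Ω ∨ dist (f y) z < ε := by
    intro z hz
    induction hz with
    | single h => exact Or.inr h
    | @tail b c _ h ih =>
      have h' : dist (f b) c < ε := h
      left
      apply hδΩ
      rw [Metric.mem_thickening_iff]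
      rcases ih with hb | hb
      · exact ⟨f b, mem_image_of_mem _ (subset_closure hb), by rw [dist_comm]; linarith⟩
      · refine ⟨f (f y), mem_image_of_mem _ hfy, ?_⟩
        have h1 := hηf b (by rw [dist_comm]; linarith)
        have h2 := dist_triangle_left c (f (f y)) (f b)
        linarith
  rcases key y (transGen_of_mem_generalizedRecurrentSet hy hε) with h | h
  · exact hyΩ h
  · linarith

end Chains

/-! ### Cells cut out by finitely many blocks -/

/-- The cell of the points that lie in the blocks marked by `σ` and whose images avoid the
closures of the others. -/
def blockCell {X ι : Type*} [TopologicalSpace X] (f : X → X) (Ω : ι → Set X) (σ : ι → Prop) :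
    Set X :=
  {y | (∀ i, σ i → y ∈ Ω i) ∧ ∀ i, ¬ σ i → f y ∉ closure (Ω i)}

section Blocks

variable {X ι : Type*} [TopologicalSpace X] {f : X ≃ₜ X} {Ω : ι → Set X}

theorem isOpen_blockCell [Finite ι] (hΩ : ∀ i, IsOpen (Ω i)) (σ : ι → Prop) :
    IsOpen (blockCell f Ω σ) := by
  have : blockCell f Ω σ = (⋂ i, ⋂ (_ : σ i), Ω i) ∩ ⋂ i, ⋂ (_ : ¬ σ i),
      f ⁻¹' (closure (Ω i))ᶜ := by
    ext y; simp [blockCell]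
  rw [this]
  refine (isOpen_iInter_of_finite fun i => isOpen_iInter_of_finite fun _ => hΩ i).inter
    (isOpen_iInter_of_finite fun i => isOpen_iInter_of_finite fun _ => ?_)
  exact isClosed_closure.isOpen_compl.preimage f.continuous

/-- The closure of the first cell lies in `closure (Ω i)`, which `f` maps into `Ω i`, whereas `f`
maps the closure of the second off `Ω i`. -/
theorem disjoint_closure_blockCell_of_mem (hΩ : ∀ i, IsOpen (Ω i))
    (hfΩ : ∀ i, ∀ y ∈ closure (Ω i), f y ∈ Ω i) {σ τ : ι → Prop} {i : ι} (hσ : σ i) (hτ : ¬ τ i) :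
    Disjoint (closure (blockCell f Ω σ)) (closure (blockCell f Ω τ)) := by
  refine Set.disjoint_left.2 fun y hy hy' => ?_
  have h1 : y ∈ closure (Ω i) := closure_mono (fun z hz => hz.1 i hσ) hy
  have h2 : y ∈ f ⁻¹' (Ω i)ᶜ := closure_minimal (fun z hz h => hz.2 i hτ (subset_closure h))
    ((hΩ i).isClosed_compl.preimage f.continuous) hy'
  exact h2 (hfΩ i y h1)

theorem disjoint_closure_blockCell (hΩ : ∀ i, IsOpen (Ω i))
    (hfΩ : ∀ i, ∀ y ∈ closure (Ω i), f y ∈ Ω i) {σ τ : ι → Prop} (h : σ ≠ τ) :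
    Disjoint (closure (blockCell f Ω σ)) (closure (blockCell f Ω τ)) := by
  obtain ⟨i, hi⟩ := Function.ne_iff.1 h
  by_cases hσ : σ i
  · exact disjoint_closure_blockCell_of_mem hΩ hfΩ hσ fun hτ => hi (by simp [hσ, hτ])
  · refine (disjoint_closure_blockCell_of_mem hΩ hfΩ (i := i) ?_ hσ).symm
    by_contra hτ
    exact hi (by simp [hσ, hτ])

theorem iterate_mem_block {S : Set X} (hS : ∀ y ∈ S, f y ∈ S) (m : ℕ) {y : X} (hy : y ∈ S) :
    f^[m] y ∈ S :=
  (show MapsTo f S S from hS).iterate m hy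

theorem mem_of_symm_iterate_mem {S : Set X} (hS : ∀ y ∈ S, f y ∈ S) {m : ℕ} {y : X}
    (hy : f.symm^[m] y ∈ S) : y ∈ S := by
  have := iterate_mem_block hS m hy
  rwa [(Function.LeftInverse.iterate (fun z => f.apply_symm_apply z) m) y] at this

/-- Forward orbits never leave a block, so every block marked at the earlier point is still marked
at the later one. -/
theorem le_of_mem_unstableSet (hfΩ : ∀ i, ∀ y ∈ Ω i, f y ∈ Ω i) {σ τ : ι → Prop}
    (h : (blockCell f Ω τ ∩ unstableSet f (blockCell f Ω σ)).Nonempty) : σ ≤ τ := by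
  obtain ⟨x, hx, m, hm⟩ := h
  intro i hi
  by_contra hτ
  exact hx.2 i hτ (subset_closure (hfΩ i x (mem_of_symm_iterate_mem (hfΩ i) (hm.1 i hi))))

/-- The past visit places `x` in the marked blocks; if `f x` were in the closure of an unmarked one,
the future visit would violate its own condition. -/
theorem mem_blockCell_of_iterate (hfΩ : ∀ i, ∀ y ∈ closure (Ω i), f y ∈ Ω i) {σ : ι → Prop}
    {x : X} {m q : ℕ} (hm : f^[m] x ∈ blockCell f Ω σ) (hq : f.symm^[q] x ∈ blockCell f Ω σ) :
    x ∈ blockCell f Ω σ := by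
  refine ⟨fun i hi => mem_of_symm_iterate_mem (fun y hy => hfΩ i y (subset_closure hy))
    (hq.1 i hi), fun i hi h => hm.2 i hi ?_⟩
  have := iterate_mem_block (f := f) (S := closure (Ω i))
    (fun y hy => subset_closure (hfΩ i y hy)) m h
  rwa [← Function.iterate_succ_apply, Function.iterate_succ_apply'] at this

end Blocks

/-- If the points outside `U` are not chain recurrent then there is an open decomposition without
cycles inside `U`. -/
theorem exists_decomposition_of_not_chainRecurrent {X : Type*} [MetricSpace X] [CompactSpace X]
    (f : X ≃ₜ X) {U : Set X} (hU : IsOpen U)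
    (h : ∀ x ∉ U, ∃ ε > 0, ¬ Relation.TransGen (ChainStep f ε) x x) :
    ∃ (k : ℕ) (V : Fin k → Set X), IsOpenDecomposition f V ∧ HasNoCycles f V ∧
      generalizedRecurrentSet f ⊆ ⋃ i, V i ∧ ⋃ i, V i ⊆ U := by
  classical
  choose! ε hε hεx using h
  obtain ⟨t, htU, ht⟩ := hU.isClosed_compl.isCompact.elim_nhds_subcover
    (fun x => f ⁻¹' chainReach f (ε x / 2) x ∩ (closure (chainReach f (ε x / 2) x))ᶜ)
    (fun x hx => IsOpen.mem_nhds
      ((isOpen_chainReach.preimage f.continuous).inter isClosed_closure.isOpen_compl)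
      ⟨.single (by simpa [ChainStep] using hε x hx), notMem_closure_chainReach (hε x hx) (hεx x hx)⟩)
  let Ω : t → Set X := fun x => chainReach f (ε x / 2) x
  have hΩ : ∀ i, IsOpen (Ω i) := fun i => isOpen_chainReach
  have hfΩ : ∀ i, ∀ y ∈ closure (Ω i), f y ∈ Ω i := fun i y hy =>
    map_closure_chainReach f.continuous (half_pos (hε _ (htU _ i.2))) hy
  let e := Fintype.equivFin (t → Prop)
  have hcov : generalizedRecurrentSet f ⊆ ⋃ i, blockCell f Ω (e.symm i) := by
    intro y hy
    refine mem_iUnion.2 ⟨e fun i => y ∈ Ω i, ?_⟩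
    rw [e.symm_apply_apply]
    exact ⟨fun i hi => hi, fun i hi hfy =>
      hi (mem_block_of_mem_generalizedRecurrentSet f.continuous (hΩ i) (hfΩ i) hy hfy)⟩
  have hlt : ∀ i j, Leads f (fun i => blockCell f Ω (e.symm i)) i j → e.symm i < e.symm j :=
    fun i j hij => lt_of_le_of_ne
      (le_of_mem_unstableSet (fun i y hy => hfΩ i y (subset_closure hy)) hij.2)
      (e.symm.injective.ne hij.1)
  refine ⟨_, fun i => blockCell f Ω (e.symm i), ⟨fun i => isOpen_blockCell hΩ _, fun i j hij =>
    disjoint_closure_blockCell hΩ hfΩ (e.symm.injective.ne hij), hcov⟩, ⟨?_, ?_⟩, hcov, ?_⟩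
  · rintro r s ⟨hr, hs⟩
    have : Nonempty (Fin r) := ⟨⟨0, by omega⟩⟩
    -- A maximal pattern along the cycle would have a strictly larger successor.
    obtain ⟨_, ⟨a, rfl⟩, ha⟩ := (Set.finite_range fun a => e.symm (s a)).exists_maximal
      (range_nonempty _)
    have h1 := hlt _ _ (hs a)
    exact h1.not_ge (ha (mem_range_self (finRotate r a)) h1.le)
  · rintro j ⟨x, hx, m, q, -, -, hm, hq⟩
    exact hx (mem_blockCell_of_iterate hfΩ hm hq)
  · refine iUnion_subset fun i y hy => ?_
    by_contra hyU
    obtain ⟨x, hx, hyx⟩ := mem_iUnion₂.1 (ht hyU)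
    -- Here `y` lies in the gap of the block of `x`, but a cell misses every gap, whether or not it
    -- marks the block.
    by_cases hi : e.symm i ⟨x, hx⟩
    · exact hyx.2 (subset_closure (hy.1 _ hi))
    · exact hy.2 _ hi (subset_closure hyx.1)

/-! ### Cut-off shears -/

section Cutoff

variable {E : Type*} [MetricSpace E]

/-- The cut-off function that is `1` on the ball of radius `2 R` and `0` off the ball of radius
`3 R`. -/
noncomputable def cutoff (z₀ : E) (R : ℝ) (z : E) : ℝ := max (min (3 - dist z z₀ / R) 1) 0

theorem abs_cutoff_sub_le {z₀ : E} {R : ℝ} (hR : 0 < R) (x y : E) :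
    |cutoff z₀ R x - cutoff z₀ R y| ≤ R⁻¹ * dist x y := by
  refine (abs_max_sub_max_le_abs _ _ _).trans ((abs_inf_sub_inf_le_abs _ _ _).trans ?_)
  rw [show (3 - dist x z₀ / R) - (3 - dist y z₀ / R) = R⁻¹ * (dist y z₀ - dist x z₀) by ring,
    abs_mul, abs_of_pos (inv_pos.2 hR), dist_comm x y]
  exact mul_le_mul_of_nonneg_left (abs_dist_sub_le _ _ _) (inv_pos.2 hR).le

theorem cutoff_mem_Icc (z₀ : E) (R : ℝ) (z : E) : cutoff z₀ R z ∈ Icc (0 : ℝ) 1 :=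
  ⟨le_max_right _ _, max_le (min_le_right _ _) zero_le_one⟩

theorem cutoff_eq_one {z₀ z : E} {R : ℝ} (hR : 0 < R) (hz : dist z z₀ ≤ 2 * R) :
    cutoff z₀ R z = 1 := by
  have : dist z z₀ / R ≤ 2 := (div_le_iff₀ hR).2 hz
  rw [cutoff, min_eq_right (by linarith), max_eq_left zero_le_one]

theorem cutoff_eq_zero {z₀ z : E} {R : ℝ} (hR : 0 < R) (hz : 3 * R ≤ dist z z₀) :
    cutoff z₀ R z = 0 := by
  have : 3 ≤ dist z z₀ / R := (le_div_iff₀ hR).2 hz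
  exact max_eq_right ((min_le_left _ _).trans (by linarith))

/-- A continuous bijection of `E`, supported in a closed ball and moving points by at most `r`. -/
structure IsBallMove (z₀ : E) (ρ r : ℝ) (S : E → E) : Prop where
  continuous : Continuous S
  bijective : Function.Bijective S
  eq_self : ∀ z, ρ ≤ dist z z₀ → S z = z
  dist_le : ∀ z, dist (S z) z ≤ r

theorem IsBallMove.comp {z₀ : E} {ρ r r' : ℝ} {S T : E → E} (hT : IsBallMove z₀ ρ r' T)
    (hS : IsBallMove z₀ ρ r S) : IsBallMove z₀ ρ (r' + r) (T ∘ S) where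
  continuous := hT.continuous.comp hS.continuous
  bijective := hT.bijective.comp hS.bijective
  eq_self z hz := by rw [Function.comp_apply, hS.eq_self z hz, hT.eq_self z hz]
  dist_le z := (dist_triangle _ (S z) _).trans (add_le_add (hT.dist_le _) (hS.dist_le _))

end Cutoff

section Shear

variable {E : Type*} [NormedAddCommGroup E] [NormedSpace ℝ E]

/-- Shears along the level sets of `ℓ`, cut off by a function `χ` with a small Lipschitz
constant, are bijective. -/
theorem bijective_shear [CompleteSpace E] (ℓ : E →L[ℝ] ℝ) {χ : E → ℝ} {φ : ℝ → E} {K r : ℝ}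
    (hK : 0 ≤ K) (hχ : ∀ x y, |χ x - χ y| ≤ K * dist x y) (hℓφ : ∀ t, ℓ (φ t) = 0)
    (hφ : ∀ t, ‖φ t‖ ≤ r) (hKr : K * r < 1) :
    Function.Bijective fun z => z + χ z • φ (ℓ z) := by
  have hr : 0 ≤ r := (norm_nonneg _).trans (hφ 0)
  have hℓ : ∀ z, ℓ (z + χ z • φ (ℓ z)) = ℓ z := fun z => by simp [hℓφ]
  have hlip : ∀ t x y, ‖(χ x - χ y) • φ t‖ ≤ K * r * dist x y := fun t x y => by
    rw [norm_smul, Real.norm_eq_abs]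
    calc |χ x - χ y| * ‖φ t‖ ≤ (K * dist x y) * r :=
          mul_le_mul (hχ x y) (hφ t) (norm_nonneg _) (by positivity)
      _ = K * r * dist x y := by ring
  constructor
  · intro x y hxy
    have hxy' : x + χ x • φ (ℓ x) = y + χ y • φ (ℓ y) := hxy
    have h1 : ℓ x = ℓ y := by rw [← hℓ x, ← hℓ y, hxy']
    rw [h1] at hxy'
    have h2 : x - y = (χ y - χ x) • φ (ℓ y) := by
      rw [sub_smul, sub_eq_sub_iff_add_eq_add, hxy', add_comm]
    have h3 := hlip (ℓ y) y x
    rw [← h2, ← dist_eq_norm, dist_comm y x] at h3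
    have h4 : 0 ≤ dist x y := dist_nonneg
    exact dist_le_zero.1 (by nlinarith)
  · intro y
    -- The shear preserves `ℓ`, so a preimage of `y` is a fixed point of this contraction with `φ`
    -- frozen at `ℓ y`.
    have hc : ContractingWith ⟨K * r, by positivity⟩ fun z => y - χ z • φ (ℓ y) := by
      refine ⟨by exact_mod_cast hKr, LipschitzWith.of_dist_le_mul fun a b => ?_⟩
      rw [dist_eq_norm, show y - χ a • φ (ℓ y) - (y - χ b • φ (ℓ y)) =
        (χ b - χ a) • φ (ℓ y) by rw [sub_smul]; abel, dist_comm a b]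
      exact hlip _ _ _
    have hz := hc.fixedPoint_isFixedPt
    set z := ContractingWith.fixedPoint _ hc
    have hz' : y - χ z • φ (ℓ y) = z := hz
    have h1 : ℓ z = ℓ y := by rw [← hz']; simp [hℓφ]
    exact ⟨z, by
      change z + χ z • φ (ℓ z) = y
      rw [h1]
      nth_rewrite 1 [← hz']
      abel⟩

/-- Interpolation of finitely many vectors by a bounded curve. -/
theorem exists_continuous_interpolation [FiniteDimensional ℝ E] {T : Set ℝ} (hT : T.Finite)
    (d : ℝ → E) {r : ℝ} (hr : 0 < r) (hd : ∀ t ∈ T, ‖d t‖ ≤ r) :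
    ∃ φ : ℝ → E, Continuous φ ∧ (∀ t, ‖φ t‖ ≤ r) ∧ ∀ t ∈ T, φ t = d t := by
  have : Finite T := hT
  have := Metric.instTietzeExtensionClosedBall (E := E) ℝ 0 hr
  obtain ⟨g, hg, hgd⟩ := ContinuousMap.exists_forall_mem_restrict_eq hT.isClosed
    (⟨fun t => d t, continuous_of_discreteTopology⟩ : C(T, E)) (t := Metric.closedBall 0 r)
    (fun t => by simpa using hd t t.2)
  exact ⟨g, g.continuous, fun t => by simpa using hg t, fun t ht => DFunLike.congr_fun hgd ⟨t, ht⟩⟩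

/-- As `ℓ` separates the points, the displacement can be prescribed as a function of `ℓ`, with value
zero over `F`, and interpolated inside the kernel of `ℓ`. The cut-off is `1 / R`-Lipschitz, so `r <
R` makes the shear bijective. -/
theorem exists_shear [FiniteDimensional ℝ E] (z₀ : E) {R r : ℝ} (hr : 0 < r) (hrR : r < R)
    (ℓ : E →L[ℝ] ℝ) (I : Finset ℕ) (a d : ℕ → E) {F : Set E} (hF : F.Finite)
    (hI : ∀ i ∈ I, ∀ j ∈ I, i ≠ j → ℓ (a i) ≠ ℓ (a j)) (hIF : ∀ i ∈ I, ∀ x ∈ F, ℓ (a i) ≠ ℓ x)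
    (hd : ∀ i ∈ I, ℓ (d i) = 0) (hdr : ∀ i ∈ I, ‖d i‖ ≤ r)
    (ha : ∀ i ∈ I, dist (a i) z₀ ≤ 2 * R) :
    ∃ S : E → E, IsBallMove z₀ (3 * R) r S ∧ (∀ i ∈ I, S (a i) = a i + d i) ∧
      ∀ x ∈ F, S x = x := by
  classical
  have hR : 0 < R := hr.trans hrR
  have : CompleteSpace E := FiniteDimensional.complete ℝ E
  let D : ℝ → LinearMap.ker (ℓ : E →ₗ[ℝ] ℝ) := fun t =>
    if h : ∃ i ∈ I, ℓ (a i) = t then ⟨d h.choose, hd _ h.choose_spec.1⟩ else 0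
  have hD : ∀ i ∈ I, (D (ℓ (a i)) : E) = d i := fun i hi => by
    have h : ∃ j ∈ I, ℓ (a j) = ℓ (a i) := ⟨i, hi, rfl⟩
    have : h.choose = i := by
      by_contra hne
      exact hI _ h.choose_spec.1 _ hi hne h.choose_spec.2
    simp only [D, dif_pos h]
    rw [this]
  have hDF : ∀ x ∈ F, D (ℓ x) = 0 := fun x hx => by
    have h : ¬ ∃ j ∈ I, ℓ (a j) = ℓ x := fun ⟨j, hj, hjx⟩ => hIF j hj x hx hjx
    simp only [D, dif_neg h]
  obtain ⟨φ, hφc, hφr, hφD⟩ := exists_continuous_interpolation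
    (T := (fun i => ℓ (a i)) '' I ∪ ℓ '' F) ((I.finite_toSet.image _).union (hF.image _)) D hr (by
      rintro _ (⟨i, hi, rfl⟩ | ⟨x, hx, rfl⟩)
      · change ‖(D (ℓ (a i)) : E)‖ ≤ r
        rw [hD i hi]; exact hdr i hi
      · rw [hDF x hx, norm_zero]; exact hr.le)
  have hχc : Continuous (cutoff z₀ R) := by unfold cutoff; fun_prop
  refine ⟨fun z => z + cutoff z₀ R z • (φ (ℓ z) : E), ⟨by fun_prop, ?_, ?_, ?_⟩, ?_, ?_⟩
  · refine bijective_shear ℓ (φ := fun t => (φ t : E)) (inv_pos.2 hR).le (abs_cutoff_sub_le hR)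
      (fun t => (φ t).2) hφr ?_
    rwa [inv_mul_lt_iff₀ hR, mul_one]
  · intro z hz
    simp [cutoff_eq_zero hR hz]
  · intro z
    rw [dist_eq_norm, add_sub_cancel_left, norm_smul, Real.norm_eq_abs,
      abs_of_nonneg (cutoff_mem_Icc _ _ _).1]
    calc _ ≤ 1 * r := mul_le_mul (cutoff_mem_Icc _ _ _).2 (hφr _) (norm_nonneg _) zero_le_one
      _ = r := one_mul r
  · intro i hi
    simp only [cutoff_eq_one hR (ha i hi), one_smul]
    rw [hφD _ (Or.inl (mem_image_of_mem _ hi)), hD i hi]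
  · intro x hx
    simp only
    rw [hφD _ (Or.inr (mem_image_of_mem _ hx)), hDF x hx]
    simp

end Shear

/-! ### Moving finitely many points of a Euclidean space -/

section Inner

variable {E : Type*} [NormedAddCommGroup E] [InnerProductSpace ℝ E]

theorem dense_inner_ne_zero {a : E} (ha : a ≠ 0) : Dense {u : E | inner ℝ u a ≠ 0} := by
  rw [Metric.dense_iff]
  intro u δ hδ
  by_cases hu : inner ℝ u a = 0
  · have hpos : 0 < ‖a‖ := norm_pos_iff.2 ha
    refine ⟨u + (δ / 2 / ‖a‖) • a, ?_, ?_⟩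
    · rw [Metric.mem_ball, dist_eq_norm, add_sub_cancel_left, norm_smul, Real.norm_eq_abs,
        abs_of_pos (by positivity), div_mul_cancel₀ _ hpos.ne']
      exact half_lt_self hδ
    · rw [mem_ofPred_eq, inner_add_left, hu, zero_add, real_inner_smul_left,
        real_inner_self_eq_norm_sq]
      positivity
  · exact ⟨u, Metric.mem_ball_self hδ, hu⟩

/-- The linear functionals that separate the points of a finite set are dense. -/
theorem exists_inner_separates [CompleteSpace E] {A : Set E} (hA : A.Finite) (e : E) {δ : ℝ}
    (hδ : 0 < δ) : ∃ u : E, ‖u - e‖ ≤ δ ∧ ∀ b ∈ A, ∀ c ∈ A, b ≠ c → inner ℝ u b ≠ inner ℝ u c := by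
  have hd : Dense (⋂ p ∈ A.offDiag, {u : E | inner ℝ u (p.1 - p.2) ≠ 0}) := by
    refine dense_biInter_of_isOpen (fun p _ => ?_) hA.offDiag.countable fun p hp =>
      dense_inner_ne_zero (sub_ne_zero.2 hp.2.2)
    exact isOpen_ne_fun (by fun_prop) continuous_const
  obtain ⟨u, hu, hue⟩ := hd.exists_dist_lt e hδ
  refine ⟨u, by rw [← dist_eq_norm, dist_comm]; exact hue.le, fun b hb c hc hbc h => ?_⟩
  refine mem_iInter₂.1 hu (b, c) ⟨hb, hc, hbc⟩ ?_
  rw [inner_sub_right, h, sub_self]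

/-- Cramer's rule in the plane of `e₀`, `e₁`: the determinant is at least `(3/4)² - (1/4)² = 1/2`
and the numerators add up to at most `5/4 + 1/4`, whence the bound 3. -/
theorem exists_dual_vector {e₀ e₁ u v : E} (h₀ : ‖e₀‖ = 1) (h₁ : ‖e₁‖ = 1) (h₀₁ : inner ℝ e₀ e₁ = 0)
    (hu : ‖u - e₀‖ ≤ 1 / 4) (hv : ‖v - e₁‖ ≤ 1 / 4) :
    ∃ w : E, inner ℝ u w = 1 ∧ inner ℝ v w = 0 ∧ ‖w‖ ≤ 3 := by
  have hb : ∀ x e : E, ‖x‖ ≤ 1 / 4 → ‖e‖ = 1 → |inner ℝ x e| ≤ 1 / 4 := fun x e hx he => by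
    have := abs_real_inner_le_norm x e
    rw [he, mul_one] at this
    exact this.trans hx
  have h10 : inner ℝ e₁ e₀ = 0 := by rw [real_inner_comm, h₀₁]
  have ha := abs_le.1 (hb _ _ hu h₀)
  have hb' := abs_le.1 (hb _ _ hu h₁)
  have hc := abs_le.1 (hb _ _ hv h₀)
  have hd := abs_le.1 (hb _ _ hv h₁)
  simp only [inner_sub_left, real_inner_self_eq_norm_sq, h₀, h₁, h₀₁, h10] at ha hb' hc hd
  set a := inner ℝ u e₀
  set b := inner ℝ u e₁
  set c := inner ℝ v e₀
  set d := inner ℝ v e₁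
  have hdet : 1 / 2 ≤ a * d - b * c := by nlinarith
  set D := a * d - b * c
  have hD : 0 < D := by linarith
  refine ⟨(d / D) • e₀ - (c / D) • e₁, ?_, ?_, ?_⟩
  · rw [inner_sub_right, real_inner_smul_right, real_inner_smul_right]
    change d / D * a - c / D * b = 1
    field_simp
    ring
  · rw [inner_sub_right, real_inner_smul_right, real_inner_smul_right]
    change d / D * c - c / D * d = 0
    ring
  · refine (norm_sub_le _ _).trans ?_
    rw [norm_smul, norm_smul, h₀, h₁, mul_one, mul_one, Real.norm_eq_abs, Real.norm_eq_abs,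
      abs_div, abs_div, abs_of_pos hD, ← add_div, div_le_iff₀ hD]
    have h1 : |d| ≤ 5 / 4 := abs_le.2 ⟨by linarith, by linarith⟩
    have h2 : |c| ≤ 1 / 4 := abs_le.2 ⟨by linarith, by linarith⟩
    linarith

/-- Simultaneous displacement of finitely many points by a composition of two shears. -/
theorem exists_ballMove [FiniteDimensional ℝ E] {e₀ e₁ : E} (h₀ : ‖e₀‖ = 1) (h₁ : ‖e₁‖ = 1)
    (h₀₁ : inner ℝ e₀ e₁ = 0) (z₀ : E) {R ε : ℝ} (hε : 0 < ε) (hεR : 5 * ε < R) (I : Finset ℕ)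
    (p q : ℕ → E) {F : Set E} (hF : F.Finite) (hpR : ∀ i ∈ I, dist (p i) z₀ ≤ R)
    (hpq : ∀ i ∈ I, dist (p i) (q i) ≤ ε) (hp : InjOn p I) (hq : InjOn q I)
    (hpF : ∀ i ∈ I, p i ∉ F) (hqF : ∀ i ∈ I, q i ∉ F) :
    ∃ S : E → E, IsBallMove z₀ (3 * R) (10 * ε) S ∧ (∀ i ∈ I, S (p i) = q i) ∧
      ∀ x ∈ F, S x = x := by
  have : CompleteSpace E := FiniteDimensional.complete ℝ E
  obtain ⟨u, hu, hus⟩ := exists_inner_separates ((I.finite_toSet.image p).union hF) e₀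
    (δ := 1 / 4) (by norm_num)
  obtain ⟨v, hv, hvs⟩ := exists_inner_separates ((I.finite_toSet.image q).union hF) e₁
    (δ := 1 / 4) (by norm_num)
  obtain ⟨w, huw, hvw, hw⟩ := exists_dual_vector h₀ h₁ h₀₁ hu hv
  have hu' : ‖u‖ ≤ 5 / 4 := by
    have := norm_add_le (u - e₀) e₀
    rw [sub_add_cancel, h₀] at this
    linarith
  -- The splitting `q i - p i = d' i + d'' i` has `d' i` orthogonal to `u` and `d'' i` orthogonal to
  -- `v`.
  let d'' : ℕ → E := fun i => inner ℝ u (q i - p i) • w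
  let d' : ℕ → E := fun i => q i - p i - d'' i
  have hn : ∀ i ∈ I, ‖q i - p i‖ ≤ ε := fun i hi => by
    rw [← dist_eq_norm, dist_comm]; exact hpq i hi
  have hd'' : ∀ i ∈ I, ‖d'' i‖ ≤ 4 * ε := fun i hi => by
    have h1 := abs_real_inner_le_norm u (q i - p i)
    have h2 : ‖u‖ * ‖q i - p i‖ ≤ 5 / 4 * ε :=
      mul_le_mul hu' (hn i hi) (norm_nonneg _) (by norm_num)
    rw [norm_smul, Real.norm_eq_abs]
    calc |inner ℝ u (q i - p i)| * ‖w‖ ≤ (5 / 4 * ε) * 3 :=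
          mul_le_mul (h1.trans h2) hw (norm_nonneg _) (by positivity)
      _ ≤ 4 * ε := by linarith
  have hd' : ∀ i ∈ I, ‖d' i‖ ≤ 5 * ε := fun i hi =>
    (norm_sub_le _ _).trans (by linarith [hn i hi, hd'' i hi])
  have hy : ∀ i, p i + d' i = q i - d'' i := fun i => by simp only [d']; abel
  obtain ⟨S, hS, hSp, hSF⟩ := exists_shear z₀ (r := 5 * ε) (by positivity) hεR (innerSL ℝ u) I
    p d' hF
    (fun i hi j hj hij => hus _ (Or.inl (mem_image_of_mem _ hi)) _ (Or.inl (mem_image_of_mem _ hj))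
      (hp.ne hi hj hij))
    (fun i hi x hx => hus _ (Or.inl (mem_image_of_mem _ hi)) _ (Or.inr hx)
      fun h => hpF i hi (h ▸ hx))
    (fun i _ => by
      rw [innerSL_apply_apply]
      simp only [d', d'']
      rw [inner_sub_right, real_inner_smul_right, huw, mul_one, sub_self])
    hd' (fun i hi => by linarith [hpR i hi])
  -- The intermediate points `q i - d'' i` have the same `v`-values as the `q i`, so they are
  -- separated by `v` too.
  have hvy : ∀ i, inner ℝ v (q i - d'' i) = inner ℝ v (q i) := fun i => by
    simp only [d'']
    rw [inner_sub_right, real_inner_smul_right, hvw, mul_zero, sub_zero]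
  obtain ⟨T, hT, hTq, hTF⟩ := exists_shear z₀ (r := 5 * ε) (by positivity) hεR (innerSL ℝ v) I
    (fun i => q i - d'' i) d'' hF
    (fun i hi j hj hij => by
      simp only [innerSL_apply_apply, hvy]
      exact hvs _ (Or.inl (mem_image_of_mem _ hi)) _ (Or.inl (mem_image_of_mem _ hj))
        (hq.ne hi hj hij))
    (fun i hi x hx => by
      simp only [innerSL_apply_apply, hvy]
      exact hvs _ (Or.inl (mem_image_of_mem _ hi)) _ (Or.inr hx) fun h => hqF i hi (h ▸ hx))
    (fun i _ => by
      rw [innerSL_apply_apply]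
      simp only [d'']
      rw [real_inner_smul_right, hvw, mul_zero])
    (fun i hi => by linarith [hd'' i hi])
    -- The first shear moves points by at most `5 * ε < R`, so they remain in the ball of radius `2
    -- * R`, where the cut-off is 1.
    (fun i hi => by
      have h1 : dist (q i - d'' i) z₀ ≤ dist (p i + d' i) (p i) + dist (p i) z₀ := by
        rw [hy]; exact dist_triangle _ _ _
      rw [dist_eq_norm (p i + d' i), add_sub_cancel_left] at h1
      linarith [hpR i hi, hd' i hi])
  refine ⟨T ∘ S, ?_, fun i hi => ?_, fun x hx => ?_⟩
  · have := hT.comp hS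
    rwa [show 5 * ε + 5 * ε = 10 * ε by ring] at this
  · rw [Function.comp_apply, hSp i hi, hy, hTq i hi, sub_add_cancel]
  · rw [Function.comp_apply, hSF x hx, hTF x hx]

end Inner

/-! ### Transport to the manifold -/

section Transport

variable {M E : Type*} [TopologicalSpace M] [NormedAddCommGroup E]

open Classical in
/-- The map of the manifold that is `S` in the chart `e`. -/
noncomputable def chartLift (e : OpenPartialHomeomorph M E) (S : E → E) (x : M) : M :=
  if x ∈ e.source then e.symm (S (e x)) else x

variable {e : OpenPartialHomeomorph M E} {S : E → E} {z₀ : E} {ρ r : ℝ}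

theorem chartLift_of_mem {x : M} (hx : x ∈ e.source) : chartLift e S x = e.symm (S (e x)) :=
  if_pos hx

theorem chartLift_of_notMem {x : M} (hx : x ∉ e.source) : chartLift e S x = x := if_neg hx

theorem chartLift_eq_self {x : M} (hx : x ∈ e.source → S (e x) = e x) : chartLift e S x = x := by
  by_cases h : x ∈ e.source
  · rw [chartLift_of_mem h, hx h, e.left_inv h]
  · exact chartLift_of_notMem h

theorem IsBallMove.mem_closedBall (hS : IsBallMove z₀ ρ r S) {z : E} (hz : S z ≠ z) :
    z ∈ Metric.closedBall z₀ ρ ∧ S z ∈ Metric.closedBall z₀ ρ :=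
  ⟨le_of_not_ge fun h => hz (hS.eq_self z h),
    le_of_not_ge fun h => hz (hS.bijective.injective (hS.eq_self _ h))⟩

theorem IsBallMove.bijective_chartLift (hS : IsBallMove z₀ ρ r S)
    (he : Metric.closedBall z₀ ρ ⊆ e.target) : Function.Bijective (chartLift e S) := by
  have hmaps : ∀ x ∈ e.source, S (e x) ∈ e.target := fun x hx => by
    by_cases h : S (e x) = e x
    · rw [h]; exact e.map_source hx
    · exact he (hS.mem_closedBall h).2
  have hsrc : ∀ x ∈ e.source, chartLift e S x ∈ e.source := fun x hx => by
    rw [chartLift_of_mem hx]; exact e.map_target (hmaps x hx)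
  constructor
  · intro x y hxy
    by_cases hx : x ∈ e.source <;> by_cases hy : y ∈ e.source
    · rw [chartLift_of_mem hx, chartLift_of_mem hy] at hxy
      exact e.injOn hx hy (hS.bijective.injective
        (e.symm.injOn (hmaps x hx) (hmaps y hy) hxy))
    · exact absurd (chartLift_of_notMem (S := S) hy ▸ hxy ▸ hsrc x hx) hy
    · exact absurd (chartLift_of_notMem (S := S) hx ▸ hxy.symm ▸ hsrc y hy) hx
    · rwa [chartLift_of_notMem hx, chartLift_of_notMem hy] at hxy
  · intro y
    by_cases hy : y ∈ e.source
    · obtain ⟨z, hz⟩ := hS.bijective.surjective (e y)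
      have hzt : z ∈ e.target := by
        by_cases h : S z = z
        · rw [← h, hz]; exact e.map_source hy
        · exact he (hS.mem_closedBall h).1
      refine ⟨e.symm z, ?_⟩
      rw [chartLift_of_mem (e.map_target hzt), e.right_inv hzt, hz, e.left_inv hy]
    · exact ⟨y, chartLift_of_notMem hy⟩

/-- The moved points lie in the image of a closed ball, which is compact and hence closed; so the
lift is the identity near any point off the chart domain. -/
theorem IsBallMove.continuous_chartLift [T2Space M] [ProperSpace E]
    (hS : IsBallMove z₀ ρ r S)
    (he : Metric.closedBall z₀ ρ ⊆ e.target) : Continuous (chartLift e S) := by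
  refine continuous_iff_continuousAt.2 fun x => ?_
  by_cases hx : x ∈ e.source
  · have hSx : S (e x) ∈ e.target := by
      by_cases h : S (e x) = e x
      · rw [h]; exact e.map_source hx
      · exact he (hS.mem_closedBall h).2
    have h1 : ContinuousAt (fun y => e.symm (S (e y))) x :=
      ContinuousAt.comp (f := fun y => S (e y)) (e.continuousAt_symm hSx)
        (hS.continuous.continuousAt.comp (e.continuousAt hx))
    refine h1.congr ?_
    filter_upwards [e.open_source.mem_nhds hx] with y hy
    exact (chartLift_of_mem hy).symm
  · have hK : IsClosed (e.symm '' Metric.closedBall z₀ ρ) :=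
      ((isCompact_closedBall z₀ ρ).image_of_continuousOn
        (e.continuousOn_symm.mono he)).isClosed
    have hxK : x ∉ e.symm '' Metric.closedBall z₀ ρ := by
      rintro ⟨z, hz, rfl⟩
      exact hx (e.map_target (he hz))
    refine continuousAt_id.congr ?_
    filter_upwards [hK.isOpen_compl.mem_nhds hxK] with y hy
    refine (chartLift_eq_self fun hys => ?_).symm
    by_contra h
    exact hy ⟨e y, (hS.mem_closedBall h).1, e.left_inv hys⟩

end Transport

/-! ### Small moves on the manifold -/

/-- Finitely many points near `s` can be moved by small distances with a homeomorphism close to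
the identity that fixes any given finite set of other points. -/
def HasSmallMoves {M : Type*} [MetricSpace M] (s : Set M) : Prop :=
  ∀ η > 0, ∃ ε > 0, ∀ (I : Finset ℕ) (p q : ℕ → M) (F : Set M), F.Finite → InjOn p I → InjOn q I →
    (∀ i ∈ I, ∀ j ∈ I, p i ≠ q j) → (∀ i ∈ I, p i ∉ F) → (∀ i ∈ I, q i ∉ F) →
    (∀ i ∈ I, p i ∈ s) → (∀ i ∈ I, dist (p i) (q i) < ε) →
    ∃ h : M ≃ₜ M, (∀ x, dist (h x) x < η) ∧ (∀ i ∈ I, h (p i) = q i) ∧ ∀ x ∈ F, h x = x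

section Moves

variable {M : Type*} [MetricSpace M]

theorem HasSmallMoves.mono {s t : Set M} (ht : HasSmallMoves t) (hst : s ⊆ t) :
    HasSmallMoves s := fun η hη => by
  obtain ⟨ε, hε, H⟩ := ht η hη
  exact ⟨ε, hε, fun I p q F hF hp hq hpq hpF hqF hs hd =>
    H I p q F hF hp hq hpq hpF hqF (fun i hi => hst (hs i hi)) hd⟩

theorem hasSmallMoves_empty : HasSmallMoves (∅ : Set M) := fun η hη =>
  ⟨1, one_pos, fun _ _ _ _ _ _ _ _ _ _ hs _ =>
    ⟨Homeomorph.refl M, fun x => by simpa using hη, fun i hi => (hs i hi).elim, fun _ _ => rfl⟩⟩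

/-- The points in `s` are moved first, with the sources and targets of the others held fixed; then
the others, with the targets already reached held fixed. The set `F` and the condition `p i ≠ q j`
in `HasSmallMoves` make this possible. -/
theorem HasSmallMoves.union {s t : Set M} (hs : HasSmallMoves s) (ht : HasSmallMoves t) :
    HasSmallMoves (s ∪ t) := by
  classical
  intro η hη
  obtain ⟨ε₁, hε₁, H₁⟩ := hs (η / 2) (half_pos hη)
  obtain ⟨ε₂, hε₂, H₂⟩ := ht (η / 2) (half_pos hη)
  refine ⟨min ε₁ ε₂, lt_min hε₁ hε₂, fun I p q F hF hp hq hpq hpF hqF hst hd => ?_⟩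
  let I₁ := I.filter fun i => p i ∈ s
  let I₂ := I.filter fun i => p i ∉ s
  have h₁ : ∀ i ∈ I₁, i ∈ I ∧ p i ∈ s := fun i hi => Finset.mem_filter.1 hi
  have h₂ : ∀ i ∈ I₂, i ∈ I ∧ p i ∉ s := fun i hi => Finset.mem_filter.1 hi
  have hs₁ : (I₁ : Set ℕ) ⊆ I := fun i hi => (h₁ i hi).1
  have hs₂ : (I₂ : Set ℕ) ⊆ I := fun i hi => (h₂ i hi).1
  have hne : ∀ i ∈ I₁, ∀ j ∈ I₂, i ≠ j := fun i hi j hj h => (h₂ j hj).2 (h ▸ (h₁ i hi).2)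
  obtain ⟨g, hgd, hgp, hgF⟩ := H₁ I₁ p q (F ∪ (p '' I₂ ∪ q '' I₂))
    (hF.union ((I₂.finite_toSet.image _).union (I₂.finite_toSet.image _)))
    (hp.mono hs₁) (hq.mono hs₁) (fun i hi j hj => hpq i (h₁ i hi).1 j (h₁ j hj).1)
    (by
      rintro i hi (h | ⟨j, hj, hji⟩ | ⟨j, hj, hji⟩)
      · exact hpF i (h₁ i hi).1 h
      · exact hne i hi j hj (hp (h₁ i hi).1 (h₂ j hj).1 hji.symm)
      · exact hpq i (h₁ i hi).1 j (h₂ j hj).1 hji.symm)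
    (by
      rintro i hi (h | ⟨j, hj, hji⟩ | ⟨j, hj, hji⟩)
      · exact hqF i (h₁ i hi).1 h
      · exact hpq j (h₂ j hj).1 i (h₁ i hi).1 hji
      · exact hne i hi j hj (hq (h₁ i hi).1 (h₂ j hj).1 hji.symm))
    (fun i hi => (h₁ i hi).2) (fun i hi => (hd i (h₁ i hi).1).trans_le (min_le_left _ _))
  obtain ⟨k, hkd, hkp, hkF⟩ := H₂ I₂ p q (F ∪ q '' I₁)
    (hF.union (I₁.finite_toSet.image _))
    (hp.mono hs₂) (hq.mono hs₂) (fun i hi j hj => hpq i (h₂ i hi).1 j (h₂ j hj).1)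
    (by
      rintro i hi (h | ⟨j, hj, hji⟩)
      · exact hpF i (h₂ i hi).1 h
      · exact hpq i (h₂ i hi).1 j (h₁ j hj).1 hji.symm)
    (by
      rintro i hi (h | ⟨j, hj, hji⟩)
      · exact hqF i (h₂ i hi).1 h
      · exact hne j hj i hi (hq (h₁ j hj).1 (h₂ i hi).1 hji))
    (fun i hi => (hst i (h₂ i hi).1).resolve_left (h₂ i hi).2)
    (fun i hi => (hd i (h₂ i hi).1).trans_le (min_le_right _ _))
  refine ⟨g.trans k, fun x => ?_, fun i hi => ?_, fun x hx => ?_⟩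
  · exact (dist_triangle _ (g x) _).trans_lt (by
      linarith [show dist ((g.trans k) x) (g x) < η / 2 from hkd (g x), hgd x])
  · rw [Homeomorph.trans_apply]
    by_cases his : p i ∈ s
    · have hi₁ : i ∈ I₁ := Finset.mem_filter.2 ⟨hi, his⟩
      rw [hgp i hi₁, hkF _ (Or.inr (mem_image_of_mem _ hi₁))]
    · have hi₂ : i ∈ I₂ := Finset.mem_filter.2 ⟨hi, his⟩
      rw [hgF _ (Or.inr (Or.inl (mem_image_of_mem _ hi₂))), hkp i hi₂]
  · rw [Homeomorph.trans_apply, hgF x (Or.inl hx), hkF x (Or.inl hx)]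

theorem exists_hasSmallMoves_nhds [CompactSpace M] {E : Type*} [NormedAddCommGroup E]
    [InnerProductSpace ℝ E] [FiniteDimensional ℝ E] {e₀ e₁ : E} (h₀ : ‖e₀‖ = 1) (h₁ : ‖e₁‖ = 1)
    (h₀₁ : inner ℝ e₀ e₁ = 0) [ChartedSpace E M] (a : M) : ∃ s ∈ 𝓝 a, HasSmallMoves s := by
  have : ProperSpace E := FiniteDimensional.proper ℝ E
  set e := chartAt E a
  have ha : a ∈ e.source := mem_chart_source E a
  obtain ⟨R', hR', hball⟩ := Metric.nhds_basis_closedBall.mem_iff.1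
    (e.open_target.mem_nhds (e.map_source ha))
  obtain ⟨R, hR, rfl⟩ : ∃ R > 0, R' = 3 * R := ⟨R' / 3, by positivity, by ring⟩
  obtain ⟨ρ, hρ, hρb⟩ := Metric.nhds_basis_closedBall.mem_iff.1
    (Filter.inter_mem (e.open_source.mem_nhds ha)
      ((e.continuousAt ha).preimage_mem_nhds (Metric.closedBall_mem_nhds (e a) hR)))
  refine ⟨Metric.ball a (ρ / 2), Metric.ball_mem_nhds a (half_pos hρ), fun η hη => ?_⟩
  obtain ⟨δ, hδ, hδη⟩ := Metric.uniformContinuousOn_iff.1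
    ((isCompact_closedBall (e a) (3 * R)).uniformContinuousOn_of_continuous
      (e.continuousOn_symm.mono hball)) η hη
  obtain ⟨ε', hε', hεR, hεδ⟩ : ∃ ε' > 0, 5 * ε' < R ∧ 10 * ε' < δ :=
    ⟨min (R / 6) (δ / 11), lt_min (by positivity) (by positivity),
      by linarith [min_le_left (R / 6) (δ / 11)], by linarith [min_le_right (R / 6) (δ / 11)]⟩
  obtain ⟨ε, hε, hεε'⟩ := Metric.uniformContinuousOn_iff.1
    (Metric.isClosed_closedBall.isCompact.uniformContinuousOn_of_continuous
      (e.continuousOn.mono fun x hx => (hρb hx).1)) ε' hε'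
  -- The bound `ρ / 2` keeps the targets `q i` in the ball of radius `ρ`, inside the chart.
  refine ⟨min ε (ρ / 2), lt_min hε (half_pos hρ),
    fun I p q F hF hp hq hpq hpF hqF hps hd => ?_⟩
  have hpρ : ∀ i ∈ I, p i ∈ Metric.closedBall a ρ := fun i hi => by
    have := Metric.mem_ball.1 (hps i hi)
    exact Metric.mem_closedBall.2 (by linarith)
  have hqρ : ∀ i ∈ I, q i ∈ Metric.closedBall a ρ := fun i hi => by
    have h1 := Metric.mem_ball.1 (hps i hi)
    have h2 := (hd i hi).trans_le (min_le_right _ _)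
    have h3 := dist_triangle_left (q i) a (p i)
    exact Metric.mem_closedBall.2 (by linarith)
  have hpe : ∀ i ∈ I, p i ∈ e.source := fun i hi => (hρb (hpρ i hi)).1
  have hqe : ∀ i ∈ I, q i ∈ e.source := fun i hi => (hρb (hqρ i hi)).1
  obtain ⟨S, hS, hSp, hSF⟩ := exists_ballMove h₀ h₁ h₀₁ (e a) hε' hεR I (fun i => e (p i))
    (fun i => e (q i)) ((hF.inter_of_left e.source).image e) (fun i hi => (hρb (hpρ i hi)).2)
    (fun i hi => (hεε' _ (hpρ i hi) _ (hqρ i hi) ((hd i hi).trans_le (min_le_left _ _))).le)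
    (fun i hi j hj hij => hp hi hj (e.injOn (hpe i hi) (hpe j hj) hij))
    (fun i hi j hj hij => hq hi hj (e.injOn (hqe i hi) (hqe j hj) hij))
    (by
      rintro i hi ⟨x, ⟨hxF, hxe⟩, hx⟩
      exact hpF i hi (e.injOn hxe (hpe i hi) hx ▸ hxF))
    (by
      rintro i hi ⟨x, ⟨hxF, hxe⟩, hx⟩
      exact hqF i hi (e.injOn hxe (hqe i hi) hx ▸ hxF))
  refine ⟨Continuous.homeoOfEquivCompactToT2
    (f := Equiv.ofBijective _ (hS.bijective_chartLift hball)) (hS.continuous_chartLift hball),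
    fun x => ?_, fun i hi => ?_, fun x hx => ?_⟩
  · change dist (chartLift e S x) x < η
    by_cases hx : x ∈ e.source → S (e x) = e x
    · rwa [chartLift_eq_self hx, dist_self]
    · obtain ⟨hxe, hxS⟩ := Classical.not_imp.1 hx
      have hb := hS.mem_closedBall hxS
      have := hδη _ hb.2 _ hb.1 ((hS.dist_le _).trans_lt hεδ)
      rwa [e.left_inv hxe, ← chartLift_of_mem hxe] at this
  · change chartLift e S (p i) = q i
    rw [chartLift_of_mem (hpe i hi), hSp i hi, e.left_inv (hqe i hi)]
  · exact chartLift_eq_self fun hxe => hSF _ (mem_image_of_mem _ ⟨hx, hxe⟩)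

theorem hasSmallMoves_univ [CompactSpace M] {E : Type*} [NormedAddCommGroup E]
    [InnerProductSpace ℝ E] [FiniteDimensional ℝ E] {e₀ e₁ : E} (h₀ : ‖e₀‖ = 1) (h₁ : ‖e₁‖ = 1)
    (h₀₁ : inner ℝ e₀ e₁ = 0) [ChartedSpace E M] : HasSmallMoves (univ : Set M) :=
  isCompact_univ.induction_on hasSmallMoves_empty (fun _ _ hst ht => ht.mono hst)
    (fun _ _ hs ht => hs.union ht) fun a _ => by
      rw [nhdsWithin_univ]
      exact exists_hasSmallMoves_nhds h₀ h₁ h₀₁ a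

/-- In a space without isolated points, finitely many points have distinct nearby points that
avoid a given finite set. -/
theorem exists_fresh_points (hM : ∀ x : M, (𝓝[≠] x).NeBot) (I : Finset ℕ) (p : ℕ → M) {B : Set M}
    (hB : B.Finite) {ε : ℝ} (hε : 0 < ε) :
    ∃ z : ℕ → M, InjOn z I ∧ (∀ i ∈ I, z i ∉ B) ∧ ∀ i ∈ I, dist (p i) (z i) < ε := by
  classical
  induction I using Finset.induction_on with
  | empty => exact ⟨p, by simp, by simp, by simp⟩
  | insert k I hk ih =>
    obtain ⟨z, hz, hzB, hzd⟩ := ih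
    have := hM (p k)
    obtain ⟨y, hy, hyB⟩ := ((infinite_of_mem_nhds (p k) (Metric.ball_mem_nhds (p k) hε)).sdiff
      (hB.union (I.finite_toSet.image z))).nonempty
    have hyz : ∀ i ∈ I, z i ≠ y := fun i hi h => hyB (Or.inr ⟨i, hi, h⟩)
    have hne : ∀ i ∈ I, i ≠ k := fun i hi h => hk (h ▸ hi)
    refine ⟨Function.update z k y, ?_, ?_, ?_⟩
    · intro i hi j hj hij
      rw [Finset.mem_coe, Finset.mem_insert] at hi hj
      rcases hi with rfl | hi <;> rcases hj with rfl | hj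
      · rfl
      · rw [Function.update_self, Function.update_of_ne (hne j hj)] at hij
        exact absurd hij.symm (hyz j hj)
      · rw [Function.update_self, Function.update_of_ne (hne i hi)] at hij
        exact absurd hij (hyz i hi)
      · rw [Function.update_of_ne (hne i hi), Function.update_of_ne (hne j hj)] at hij
        exact hz hi hj hij
    · intro i hi
      rcases Finset.mem_insert.1 hi with rfl | hi
      · rw [Function.update_self]; exact fun h => hyB (Or.inl h)
      · rw [Function.update_of_ne (hne i hi)]; exact hzB i hi
    · intro i hi
      rcases Finset.mem_insert.1 hi with rfl | hi
      · rw [Function.update_self, dist_comm]; exact hy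
      · rw [Function.update_of_ne (hne i hi)]; exact hzd i hi

/-- Moving through fresh intermediate points removes the condition `p i ≠ q j`, which need not hold
along a chain. -/
theorem HasSmallMoves.exists_homeomorph (hM : ∀ x : M, (𝓝[≠] x).NeBot)
    (h : HasSmallMoves (univ : Set M)) {η : ℝ} (hη : 0 < η) :
    ∃ ε > 0, ∀ (I : Finset ℕ) (p q : ℕ → M), InjOn p I → InjOn q I →
      (∀ i ∈ I, dist (p i) (q i) < ε) →
      ∃ g : M ≃ₜ M, (∀ x, dist (g x) x < η) ∧ ∀ i ∈ I, g (p i) = q i := by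
  obtain ⟨ε, hε, H⟩ := h (η / 2) (half_pos hη)
  refine ⟨ε / 2, half_pos hε, fun I p q hp hq hd => ?_⟩
  obtain ⟨z, hz, hzB, hzd⟩ := exists_fresh_points hM I p
    ((I.finite_toSet.image p).union (I.finite_toSet.image q)) (half_pos hε)
  obtain ⟨g, hgd, hg, -⟩ := H I p z ∅ finite_empty hp hz
    (fun i hi j hj h => hzB j hj (Or.inl ⟨i, hi, h⟩)) (by simp) (by simp) (by simp)
    fun i hi => (hzd i hi).trans (half_lt_self hε)
  obtain ⟨k, hkd, hk, -⟩ := H I z q ∅ finite_empty hz hq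
    (fun i hi j hj h => hzB i hi (Or.inr ⟨j, hj, h.symm⟩)) (by simp) (by simp) (by simp)
    fun i hi => by linarith [dist_triangle_left (z i) (q i) (p i), hzd i hi, hd i hi]
  refine ⟨g.trans k, fun x => ?_, fun i hi => ?_⟩
  · exact (dist_triangle _ (g x) _).trans_lt (by
      linarith [show dist ((g.trans k) x) (g x) < η / 2 from hkd (g x), hgd x])
  · rw [Homeomorph.trans_apply, hg i hi, hk i hi]

/-! ### The closing lemma -/

/-- The points of a shortest closed chain are distinct. -/
theorem exists_injOn_closed_chain {X : Type*} {R : X → X → Prop} {x : X}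
    (h : Relation.TransGen R x x) :
    ∃ (n : ℕ) (c : ℕ → X), 0 < n ∧ c 0 = x ∧ c n = x ∧ (∀ i < n, R (c i) (c (i + 1))) ∧
      InjOn c (Iio n) := by
  classical
  have hex : ∃ n, 0 < n ∧ ∃ c : ℕ → X, c 0 = x ∧ c n = x ∧ ∀ i < n, R (c i) (c (i + 1)) := by
    have key : ∀ y, Relation.TransGen R x y →
        ∃ n, 0 < n ∧ ∃ c : ℕ → X, c 0 = x ∧ c n = y ∧ ∀ i < n, R (c i) (c (i + 1)) := by
      intro y hy
      induction hy with
      | @single y h =>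
        refine ⟨1, one_pos, fun i => if i = 0 then x else y, rfl, rfl, fun i hi => ?_⟩
        obtain rfl : i = 0 := by omega
        simpa using h
      | @tail y z _ hyz ih =>
        obtain ⟨n, hn, c, h0, hcn, hc⟩ := ih
        refine ⟨n + 1, by omega, fun i => if i ≤ n then c i else z, by simpa using h0, by simp,
          fun i hi => ?_⟩
        rcases Nat.lt_succ_iff_lt_or_eq.1 hi with hi | rfl
        · simpa [hi.le, Nat.succ_le_of_lt hi] using hc i hi
        · simpa [hcn] using hyz
    exact key x h
  obtain ⟨hn, c, h0, hcn, hc⟩ := Nat.find_spec hex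
  set n := Nat.find hex
  -- If `c i = c j`, cutting out the loop between them leaves a closed chain shorter by `j - i`.
  have key : ∀ i j, i < j → j < n → c i ≠ c j := by
    intro i j hij hj heq
    refine Nat.find_min hex (m := n - (j - i)) (by omega) ⟨by omega,
      fun l => if l ≤ i then c l else c (l + (j - i)), by simpa using h0, ?_, fun l hl => ?_⟩
    · beta_reduce
      rw [if_neg (by omega), Nat.sub_add_cancel (by omega), hcn]
    · beta_reduce
      rcases lt_trichotomy l i with hli | rfl | hli
      · rw [if_pos hli.le, if_pos (by omega)]
        exact hc l (by omega)
      · rw [if_pos le_rfl, if_neg (by omega), heq, show l + 1 + (j - l) = j + 1 by omega]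
        exact hc j hj
      · rw [if_neg (by omega), if_neg (by omega), show l + 1 + (j - i) = l + (j - i) + 1 by omega]
        exact hc _ (by omega)
  refine ⟨n, c, hn, h0, hcn, hc, fun i hi j hj hij => ?_⟩
  rcases lt_trichotomy i j with h | h | h
  · exact absurd hij (key i j h hj)
  · exact h
  · exact absurd hij.symm (key j i h hi)

/-- A `C⁰` closing lemma for chain recurrent points. -/
theorem exists_homeomorph_isPeriodicPt (hM : ∀ x : M, (𝓝[≠] x).NeBot)
    (h : HasSmallMoves (univ : Set M)) (f : M ≃ₜ M) {x : M}
    (hx : ∀ ε > 0, Relation.TransGen (ChainStep f ε) x x) {η : ℝ} (hη : 0 < η) :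
    ∃ g : M ≃ₜ M, (∀ y, dist (g y) (f y) < η) ∧ ∃ n > 0, g^[n] x = x := by
  obtain ⟨ε, hε, H⟩ := h.exists_homeomorph hM hη
  obtain ⟨n, c, hn, h0, hcn, hc, hinj⟩ := exists_injOn_closed_chain (hx ε hε)
  obtain ⟨k, hkd, hk⟩ := H (Finset.range n) (fun i => f (c i)) (fun i => c (i + 1))
    (fun i hi j hj hij => hinj (by simpa using hi) (by simpa using hj) (f.injective hij))
    (by
      intro i hi j hj hij
      rw [Finset.mem_coe, Finset.mem_range] at hi hj
      have hij' : c (i + 1) = c (j + 1) := hij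
      -- Since `c n = c 0`, the targets `c 1, …, c n` are a cyclic shift of the distinct points `c
      -- 0, …, c (n - 1)`.
      have h0n : c 0 = c n := h0.trans hcn.symm
      rcases Nat.lt_or_ge (i + 1) n with hi' | hi' <;> rcases Nat.lt_or_ge (j + 1) n with hj' | hj'
      · exact Nat.succ_injective (hinj hi' hj' hij')
      · rw [show j + 1 = n by omega, ← h0n] at hij'
        exact absurd (hinj hi' hn hij') (by omega)
      · rw [show i + 1 = n by omega, ← h0n] at hij'
        exact absurd (hinj hn hj' hij') (by omega)
      · omega)
    (fun i hi => hc i (Finset.mem_range.1 hi))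
  refine ⟨f.trans k, fun y => hkd (f y), n, hn, ?_⟩
  have key : ∀ i ≤ n, (f.trans k)^[i] x = c i := by
    intro i
    induction i with
    | zero => exact fun _ => h0.symm
    | succ i ih =>
      intro hi
      rw [Function.iterate_succ_apply', ih (by omega), Homeomorph.trans_apply]
      exact hk i (Finset.mem_range.2 hi)
  rw [key n le_rfl, hcn]

end Moves

theorem nhdsNE_neBot_of_chartedSpace {M E : Type*} [TopologicalSpace M] [TopologicalSpace E]
    [ChartedSpace E M] (hE : ∀ z : E, (𝓝[≠] z).NeBot) (x : M) : (𝓝[≠] x).NeBot := by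
  set e := chartAt E x
  have hx : x ∈ e.source := mem_chart_source E x
  have := hE (e x)
  have h1 : Filter.Tendsto e.symm (𝓝[≠] (e x)) (𝓝[≠] x) := by
    refine tendsto_nhdsWithin_iff.2 ⟨?_, ?_⟩
    · have := (e.continuousAt_symm (e.map_source hx)).tendsto
      rw [e.left_inv hx] at this
      exact this.mono_left nhdsWithin_le_nhds
    · filter_upwards [nhdsWithin_le_nhds (e.open_target.mem_nhds (e.map_source hx)),
        self_mem_nhdsWithin] with z hz hzx h
      exact hzx (by rw [mem_singleton_iff, ← e.right_inv hz, mem_singleton_iff.1 h])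
  exact h1.neBot

end GenRec

theorem mainTheorem2 {M : Type*} [MetricSpace M] [CompactSpace M] (n : ℕ) (hn : 2 ≤ n)
    [ChartedSpace (EuclideanSpace ℝ (Fin n)) M] (f : M ≃ₜ M)
    (hf : GenRec.generalizedRecurrentSet f ≠ Set.univ) (hexp : GenRec.NoGRExplosions f)
    (U : Set M) (hU : IsOpen U) (hGU : GenRec.generalizedRecurrentSet f ⊆ U) :
    ∃ (k : ℕ) (V : Fin k → Set M), GenRec.IsOpenDecomposition f V ∧ GenRec.HasNoCycles f V ∧
      GenRec.generalizedRecurrentSet f ⊆ ⋃ i, V i ∧ ⋃ i, V i ⊆ U := by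
  have : Nontrivial (Fin n) := Fin.nontrivial_iff_two_le.2 hn
  refine GenRec.exists_decomposition_of_not_chainRecurrent f hU fun x hxU => ?_
  -- A chain recurrent `x` off `U` would be periodic for some `g` near `f`, an explosion out of `U`.
  by_contra! hx
  obtain ⟨N, hN, hNU⟩ := hexp U hU hGU
  obtain ⟨η, hη, hηN⟩ := Metric.mem_nhds_iff.1 hN
  have hM : ∀ x : M, (𝓝[≠] x).NeBot :=
    GenRec.nhdsNE_neBot_of_chartedSpace (E := EuclideanSpace ℝ (Fin n))
      fun z => Module.punctured_nhds_neBot ℝ _ z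
  obtain ⟨i, j, hij⟩ := exists_pair_ne (Fin n)
  have hmoves : GenRec.HasSmallMoves (Set.univ : Set M) :=
    GenRec.hasSmallMoves_univ (e₀ := EuclideanSpace.single i (1 : ℝ))
      (e₁ := EuclideanSpace.single j (1 : ℝ)) (by simp) (by simp)
      (by simp [EuclideanSpace.inner_single_left, hij])
  obtain ⟨g, hg, m, hm, hgx⟩ := GenRec.exists_homeomorph_isPeriodicPt hM hmoves f hx hη
  refine hxU (hNU g (hηN ?_) (GenRec.mem_generalizedRecurrentSet_of_isPeriodicPt hm hgx))
  exact (ContinuousMap.dist_lt_iff (f := ⟨g, g.continuous⟩) (g := ⟨f, f.continuous⟩) hη).2 hg
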